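/- Let $M,K$ be integers with $1\le K\le M$, let $0\le\mu<1$, $R>0$, and put $z=2^R-1$. For a transmit power $P_S>0$, a noise power $\sigma^2>0$ and a channel variance $\alpha>0$, let $h_0,e_1,\dots,e_M$ be independent circularly-symmetric complex Gaussian random variables $\mathcal{CN}(0,\alpha)$, and define the port channels and port SNRs of a fluid antenna system by $$h_m=\sqrt{\mu}\,h_0+\sqrt{1-\mu}\,e_m,\qquad \gamma_m=\frac{P_S|h_m|^2}{\sigma^2},\qquad m=1,\dots,M.$$ Let $\mathbb K$ be a set of $K$ ports with the $K$ largest values among $\gamma_1,\dots,\gamma_M$ and let $$P_{\rm out}=\Pr\Big(\log_2\Big(1+\sum_{m\in\mathbb K}\gamma_m\Big)\le R\Big)$$ be the outage probability under maximum ratio combining of the selected ports. Let $\phi=P_S\alpha/\sigma^2$ be the average SNR and $\omega=(\phi(1-\mu))^{-1}$. Keep $M,K,\mu,R$ fixed and let $P_S,\alpha,\sigma^2$ vary in any way such that $\phi\to\infty$. Then the following hold. (i) If $K<M$, then, with $T=M-K-1$, $$P_{\rm out}\sim\psi\,(z\omega)^M,\qquad \psi=\binom{M}{K}\frac{(T+1)(1-\mu)}{K!\,(M\mu+1-\mu)\,K^{T+1}}\sum_{k=0}^{K}\binom{K}{k}\frac{(-1)^k}{k+T+1},$$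 that is, the ratio of the two sides tends to $1$. (ii) For every $1\le K\le M$ the diversity order equals the total number of ports, whatever the number $K$ of activated ports: $$-\frac{\log P_{\rm out}}{\log\phi}\longrightarrow M .$$ -/

import Mathlib

open MeasureTheory ProbabilityTheory Filter Topology Asymptotics

namespace FAS

noncomputable section

/-- The circularly-symmetric complex Gaussian law `CN(0, α)`: independent real and imaginary parts,
each `N(0, α / 2)`. -/
def complexGaussian (α : ℝ) : Measure ℂ :=
  ((gaussianReal 0 (Real.toNNReal (α / 2))).prod (gaussianReal 0 (Real.toNNReal (α / 2)))).map
    (fun p : ℝ × ℝ => (⟨p.1, p.2⟩ : ℂ))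

/-- The joint law of `(h₀, (e₁, …, e_M))`: the reference channel and the `M` innovations are
independent `CN(0, α)` variables. -/
def channelLaw (M : ℕ) (α : ℝ) : Measure (ℂ × (Fin M → ℂ)) :=
  (complexGaussian α).prod (Measure.pi fun _ : Fin M => complexGaussian α)

/-- The channel of port `m`: `h_m = √μ h₀ + √(1 - μ) e_m`. -/
def portChannel {M : ℕ} (μ : ℝ) (w : ℂ × (Fin M → ℂ)) (m : Fin M) : ℂ :=
  (Real.sqrt μ : ℂ) * w.1 + (Real.sqrt (1 - μ) : ℂ) * w.2 m

/-- The received SNR of port `m`: `γ_m = P_S |h_m|² / σ²`, where `N` is the noise power `σ²`. -/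
def portSNR {M : ℕ} (PS N μ : ℝ) (w : ℂ × (Fin M → ℂ)) (m : Fin M) : ℝ :=
  PS * ‖portChannel μ w m‖ ^ 2 / N

/-- `S` is a set of `K` ports with the `K` highest values of `γ` among all `M` ports. -/
def IsKMax {M : ℕ} (K : ℕ) (γ : Fin M → ℝ) (S : Finset (Fin M)) : Prop :=
  S.card = K ∧ ∀ i ∈ S, ∀ j ∉ S, γ j ≤ γ i

/-- A set of `K` best ports exists. -/
theorem exists_isKMax {M : ℕ} (K : ℕ) (hK : K ≤ M) (γ : Fin M → ℝ) :
    ∃ S, IsKMax K γ S := by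
  induction K with
  | zero => exact ⟨∅, by simp [IsKMax]⟩
  | succ k ih =>
    obtain ⟨S, hS, hmax⟩ := ih (by omega)
    have hne : (Sᶜ).Nonempty := by
      rw [← Finset.card_pos, Finset.card_compl, Fintype.card_fin]; omega
    obtain ⟨a, ha, hamax⟩ := Finset.exists_max_image Sᶜ γ hne
    rw [Finset.mem_compl] at ha
    refine ⟨insert a S, by rw [Finset.card_insert_of_notMem ha, hS], ?_⟩
    intro i hi j hj
    rw [Finset.mem_insert, not_or] at hj
    rcases Finset.mem_insert.1 hi with rfl | hi
    · exact hamax j (by simpa using hj.2)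
    · exact hmax i hi j hj.2

/-- The combined SNR does not depend on how ties are broken. -/
theorem IsKMax.sum_eq {M K : ℕ} {γ : Fin M → ℝ} {S T : Finset (Fin M)}
    (hS : IsKMax K γ S) (hT : IsKMax K γ T) : ∑ m ∈ S, γ m = ∑ m ∈ T, γ m := by
  have key : ∀ {S T : Finset (Fin M)}, IsKMax K γ S → IsKMax K γ T →
      ∑ m ∈ T, γ m ≤ ∑ m ∈ S, γ m := by
    intro S T hS hT
    have hc : (T \ S).card = (S \ T).card := by
      rw [Finset.card_sdiff_comm]; rw [hS.1, hT.1]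
    have h1 : ∑ m ∈ T \ S, γ m ≤ ∑ m ∈ S \ T, γ m := by
      rcases (T \ S).eq_empty_or_nonempty with h | h
      · rw [h, Finset.card_empty] at hc
        rw [h, Finset.card_eq_zero.1 hc.symm]
      · obtain ⟨a, ha, hamax⟩ := Finset.exists_max_image (T \ S) γ h
        calc ∑ m ∈ T \ S, γ m ≤ (T \ S).card • γ a := Finset.sum_le_card_nsmul _ _ _ hamax
          _ = (S \ T).card • γ a := by rw [hc]
          _ ≤ ∑ m ∈ S \ T, γ m := Finset.card_nsmul_le_sum _ _ _ (fun i hi =>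
              hS.2 i (Finset.mem_sdiff.1 hi).1 a (Finset.mem_sdiff.1 ha).2)
    have h2 := Finset.sum_sdiff_sub_sum_sdiff (s₁ := T) (s₂ := S) (f := γ)
    linarith
  exact le_antisymm (key hT hS) (key hS hT)

/-- The outage event: the rate supported by maximum ratio combining of the `K` best of the
`M` ports, `log₂ (1 + ∑_{m ∈ 𝕂} γ_m)`, is at most `R`. -/
def outageEvent (M K : ℕ) (R PS N μ : ℝ) : Set (ℂ × (Fin M → ℂ)) :=
  {w | ∃ S : Finset (Fin M), IsKMax K (portSNR PS N μ w) S ∧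
    Real.logb 2 (1 + ∑ m ∈ S, portSNR PS N μ w m) ≤ R}

/-- The outage probability, for transmit power `PS`, channel variance `α`, noise power `N`. -/
def outageProb (M K : ℕ) (R PS α N μ : ℝ) : ℝ :=
  (channelLaw M α).real (outageEvent M K R PS N μ)

/-- The average received SNR `φ = P_S α / σ²`. -/
def avgSNR (PS α N : ℝ) : ℝ := PS * α / N

/-- `ω = (φ (1 - μ))⁻¹`. -/
def omega (φ μ : ℝ) : ℝ := (φ * (1 - μ))⁻¹

/-- The constant `ψ` (for `1 ≤ K < M`), with `T + 1 = M - K`. -/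
def psi (M K : ℕ) (μ : ℝ) : ℝ :=
  (M.choose K : ℝ) *
    (((M : ℝ) - K) * (1 - μ) /
      ((K.factorial : ℝ) * ((M : ℝ) * μ + 1 - μ) * (K : ℝ) ^ (M - K))) *
    ∑ k ∈ Finset.range (K + 1), (-1 : ℝ) ^ k * (K.choose k : ℝ) / ((k : ℝ) + ((M : ℝ) - K))

/-- `d` is the diversity order, along `l`, of an error or outage probability `p` at SNR `snr`:
`- log p / log snr → d`. -/
def HasDiversityOrder {ι : Type*} (l : Filter ι) (snr p : ι → ℝ) (d : ℝ) : Prop :=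
  Tendsto (fun i => - Real.log (p i) / Real.log (snr i)) l (𝓝 d)

end

end FAS

namespace FAS

/-! Rescale the port vector so that outage means membership in a fixed set `outageRegion M K` of
`ℂ^M`: every `K`-element sum of `‖v m‖ ^ 2` is at most 1. Given the reference channel, the rescaled
vector has an explicit Gaussian density, so with `l = φ / z` the outage probability is exactly `(π l
(1 - μ))⁻ᴹ` times the integral of `densityKernel` over a standard Gaussian times Lebesgue measure on
the region (`outageProb_eq_integral`). As `l → ∞` the kernel, bounded by 1, tends to `exp (-(M μ /
(1 - μ)) |g|²)`, and dominated convergence leaves the volume of the region times `(1 - μ) / (M μ + 1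
- μ)`.

The diversity order only needs this coefficient to be positive and finite, hence holds for `K = M`
too. For the constant when `K < M`, the map `w ↦ π |w|²` carries area on `ℂ` to Lebesgue measure on
`[0, ∞)`. The volume then splits, up to ties, into `M.choose K` congruent cells indexed by the set
of largest coordinates, and each is computed by Fubini, the layer-cake formula and the simplex
volume (`pi_halfLineVolume_topCell`). -/

/-! ### Densities of complex Gaussian laws -/

theorem measurable_complex_mk : Measurable fun p : ℝ × ℝ => (⟨p.1, p.2⟩ : ℂ) :=
  Complex.measurableEquivRealProd.symm.measurable

instance (α : ℝ) : IsProbabilityMeasure (complexGaussian α) := by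
  unfold complexGaussian
  exact Measure.isProbabilityMeasure_map measurable_complex_mk.aemeasurable

/-- The density of a circularly-symmetric complex Gaussian with mean `m` and variance `v`. -/
noncomputable def complexGaussianDensity (m : ℂ) (v : ℝ) (w : ℂ) : ℝ :=
  (Real.pi * v)⁻¹ * Real.exp (-‖w - m‖ ^ 2 / v)

theorem complexGaussianDensity_nonneg (m : ℂ) {v : ℝ} (hv : 0 < v) (w : ℂ) :
    0 ≤ complexGaussianDensity m v w := by
  unfold complexGaussianDensity; positivity

theorem continuous_complexGaussianDensity (m : ℂ) (v : ℝ) :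
    Continuous (complexGaussianDensity m v) := by
  unfold complexGaussianDensity; fun_prop

theorem gaussianPDFReal_mul_gaussianPDFReal (m : ℂ) {v : ℝ} (hv : 0 < v) (x y : ℝ) :
    gaussianPDFReal m.re (Real.toNNReal (v / 2)) x * gaussianPDFReal m.im (Real.toNNReal (v / 2)) y
      = complexGaussianDensity m v ⟨x, y⟩ := by
  simp only [gaussianPDFReal, complexGaussianDensity, Real.coe_toNNReal _ (half_pos hv).le]
  have h2 : (2 : ℝ) * Real.pi * (v / 2) = Real.pi * v := by ring
  rw [h2, mul_mul_mul_comm, ← mul_inv, Real.mul_self_sqrt (by positivity), ← Real.exp_add]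
  congr 2
  rw [Complex.sq_norm, Complex.normSq_apply]
  simp only [Complex.sub_re, Complex.sub_im]
  field_simp
  ring

/-- Real and imaginary parts are transformed separately, and the product of the two real densities
depends only on the distance to `m`. -/
theorem map_affine_complexGaussian (m : ℂ) {s α : ℝ} (hs : 0 < s) (hα : 0 < α) :
    (complexGaussian α).map (fun e => m + (s : ℂ) * e) =
      volume.withDensity fun w => ENNReal.ofReal (complexGaussianDensity m (s ^ 2 * α) w) := by
  have hv : 0 < s ^ 2 * α := by positivity
  have hmk := measurable_complex_mk
  have hre (a : ℝ) : (gaussianReal 0 (Real.toNNReal (α / 2))).map (fun x => a + s * x) =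
      gaussianReal a (Real.toNNReal (s ^ 2 * α / 2)) := by
    have : (fun x : ℝ => a + s * x) = (fun x => a + x) ∘ (fun x => s * x) := rfl
    rw [this, ← Measure.map_map (by fun_prop) (by fun_prop), gaussianReal_map_const_mul,
      gaussianReal_map_const_add]
    congr 1
    · simp
    · apply NNReal.eq
      rw [Real.coe_toNNReal _ (by positivity)]
      simp [Real.coe_toNNReal _ (half_pos hα).le]
      ring
  have hcomp : (fun e : ℂ => m + (s : ℂ) * e) ∘ (fun p : ℝ × ℝ => (⟨p.1, p.2⟩ : ℂ)) =
      (fun p : ℝ × ℝ => (⟨p.1, p.2⟩ : ℂ)) ∘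
        Prod.map (fun x => m.re + s * x) (fun x => m.im + s * x) := by
    funext p
    apply Complex.ext <;> simp
  have hv' : Real.toNNReal (s ^ 2 * α / 2) ≠ 0 := by
    rw [Ne, Real.toNNReal_eq_zero]; linarith
  rw [complexGaussian, Measure.map_map (by fun_prop) hmk, hcomp,
    ← Measure.map_map hmk (by fun_prop), ← Measure.map_prod_map _ _ (by fun_prop) (by fun_prop),
    hre, hre, gaussianReal_of_var_ne_zero _ hv', gaussianReal_of_var_ne_zero _ hv',
    prod_withDensity (measurable_gaussianPDF _ _) (measurable_gaussianPDF _ _)]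
  ext t ht
  rw [Measure.map_apply hmk ht, withDensity_apply _ (hmk ht), withDensity_apply _ ht,
    ← (Complex.volume_preserving_equiv_real_prod.symm _).setLIntegral_comp_preimage ht
      (continuous_complexGaussianDensity _ _).measurable.ennreal_ofReal]
  refine setLIntegral_congr_fun (hmk ht) fun p _ => ?_
  change ENNReal.ofReal _ * ENNReal.ofReal _ = _
  rw [← ENNReal.ofReal_mul (gaussianPDFReal_nonneg _ _ _),
    gaussianPDFReal_mul_gaussianPDFReal m hv]
  rfl

theorem complexGaussian_eq_withDensity {α : ℝ} (hα : 0 < α) :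
    complexGaussian α =
      volume.withDensity fun w => ENNReal.ofReal (complexGaussianDensity 0 α w) := by
  simpa using map_affine_complexGaussian 0 one_pos hα

theorem complexGaussian_eq_map {α : ℝ} (hα : 0 < α) :
    complexGaussian α = (complexGaussian 1).map fun g => (Real.sqrt α : ℂ) * g := by
  have := map_affine_complexGaussian 0 (Real.sqrt_pos.2 hα) one_pos
  rw [Real.sq_sqrt hα.le, mul_one, ← complexGaussian_eq_withDensity hα] at this
  simpa using this.symm

/-- A finite product of measures with integrable densities has the product density. -/
theorem pi_withDensity_ofReal {ι : Type*} [Fintype ι] {E : Type*} [MeasurableSpace E]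
    {μ : Measure E} [SigmaFinite μ] {f : E → ℝ} (h0 : ∀ x, 0 ≤ f x)
    (hi : Integrable f μ) :
    Measure.pi (fun _ : ι => μ.withDensity fun x => ENNReal.ofReal (f x)) =
      (Measure.pi fun _ : ι => μ).withDensity fun x => ENNReal.ofReal (∏ i, f (x i)) := by
  have : SigmaFinite (μ.withDensity fun x => ENNReal.ofReal (f x)) :=
    SigmaFinite.withDensity_ofReal f
  refine Measure.pi_eq fun s hs => ?_
  have hm : MeasurableSet (Set.univ.pi s) := MeasurableSet.univ_pi hs
  rw [withDensity_apply _ hm, Measure.restrict_pi_pi,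
    ← ofReal_integral_eq_lintegral_ofReal
      (Integrable.fintype_prod (f := fun _ => f) fun i => hi.restrict)
      (Eventually.of_forall fun x => Finset.prod_nonneg fun i _ => h0 _),
    integral_fintype_prod_eq_prod (fun _ => f),
    ENNReal.ofReal_prod_of_nonneg fun i _ => integral_nonneg fun x => h0 x]
  refine Finset.prod_congr rfl fun i _ => ?_
  rw [withDensity_apply _ (hs i), ofReal_integral_eq_lintegral_ofReal hi.restrict
    (Eventually.of_forall h0)]

theorem integrable_complexGaussianDensity (m : ℂ) {v : ℝ} (hv : 0 < v) :
    Integrable (complexGaussianDensity m v) := by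
  have h := map_affine_complexGaussian m one_pos hv
  rw [one_pow, one_mul] at h
  refine ⟨(continuous_complexGaussianDensity m v).aestronglyMeasurable, ?_⟩
  rw [hasFiniteIntegral_iff_ofReal (Eventually.of_forall (complexGaussianDensity_nonneg m hv)),
    ← setLIntegral_univ, ← withDensity_apply _ MeasurableSet.univ, ← h]
  have := Measure.isProbabilityMeasure_map (μ := complexGaussian v)
    (f := fun e : ℂ => m + ((1 : ℝ) : ℂ) * e) (by fun_prop)
  exact measure_lt_top _ _

/-- With `m` a multiple of the reference channel, this is the conditional density of the scaled port
vector. -/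
theorem pi_complexGaussian_map_affine (M : ℕ) (m : ℂ) {s α : ℝ} (hs : 0 < s) (hα : 0 < α) :
    (Measure.pi fun _ : Fin M => complexGaussian α).map (fun e i => m + (s : ℂ) * e i) =
      volume.withDensity fun w => ENNReal.ofReal
        (∏ i, complexGaussianDensity m (s ^ 2 * α) (w i)) := by
  have hv : 0 < s ^ 2 * α := by positivity
  have : ∀ i : Fin M, IsProbabilityMeasure
      ((complexGaussian α).map fun e : ℂ => m + (s : ℂ) * e) := fun _ =>
    Measure.isProbabilityMeasure_map (by fun_prop)
  rw [Measure.pi_map_pi (f := fun (_ : Fin M) (e : ℂ) => m + (s : ℂ) * e) (by fun_prop),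
    map_affine_complexGaussian m hs hα,
    pi_withDensity_ofReal (complexGaussianDensity_nonneg _ hv)
      (integrable_complexGaussianDensity _ hv)]
  rfl

/-! ### Outage as membership in a fixed region -/

/-- Exchange argument: `T \ S` and `S \ T` have equal size, and each value on `S \ T` dominates each
value on `T \ S`. -/
theorem IsKMax.sum_le {M K : ℕ} {γ : Fin M → ℝ} {S T : Finset (Fin M)}
    (hS : IsKMax K γ S) (hT : T.card = K) : ∑ m ∈ T, γ m ≤ ∑ m ∈ S, γ m := by
  have hc : (T \ S).card = (S \ T).card := by
    rw [Finset.card_sdiff_comm]; rw [hS.1, hT]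
  have h1 : ∑ m ∈ T \ S, γ m ≤ ∑ m ∈ S \ T, γ m := by
    rcases (T \ S).eq_empty_or_nonempty with h | h
    · rw [h, Finset.card_empty] at hc
      rw [h, Finset.card_eq_zero.1 hc.symm]
    · obtain ⟨a, ha, hamax⟩ := Finset.exists_max_image (T \ S) γ h
      calc ∑ m ∈ T \ S, γ m ≤ (T \ S).card • γ a := Finset.sum_le_card_nsmul _ _ _ hamax
        _ = (S \ T).card • γ a := by rw [hc]
        _ ≤ ∑ m ∈ S \ T, γ m := Finset.card_nsmul_le_sum _ _ _ (fun i hi =>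
            hS.2 i (Finset.mem_sdiff.1 hi).1 a (Finset.mem_sdiff.1 ha).2)
  have h2 := Finset.sum_sdiff_sub_sum_sdiff (s₁ := T) (s₂ := S) (f := γ)
  linarith

/-- The vectors all of whose `K`-element partial sums are at most `r`. -/
def partialSumsLE (M K : ℕ) (r : ℝ) : Set (Fin M → ℝ) :=
  {x | ∀ S : Finset (Fin M), S.card = K → ∑ m ∈ S, x m ≤ r}

theorem isClosed_partialSumsLE (M K : ℕ) (r : ℝ) : IsClosed (partialSumsLE M K r) := by
  have : partialSumsLE M K r =
      ⋂ S : Finset (Fin M), ⋂ _ : S.card = K, {x | ∑ m ∈ S, x m ≤ r} := by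
    ext x; simp [partialSumsLE]
  rw [this]
  exact isClosed_iInter fun S => isClosed_iInter fun _ =>
    isClosed_le (by fun_prop) continuous_const

theorem mem_partialSumsLE_iff_of_isKMax {M K : ℕ} {r : ℝ} {x : Fin M → ℝ} {S : Finset (Fin M)}
    (hS : IsKMax K x S) : x ∈ partialSumsLE M K r ↔ ∑ m ∈ S, x m ≤ r :=
  ⟨fun h => h S hS.1, fun h _ hT => (hS.sum_le hT).trans h⟩

theorem mem_outageEvent_iff {M K : ℕ} (hKM : K ≤ M) {R PS N μ : ℝ} (hPS : 0 < PS) (hN : 0 < N)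
    (w : ℂ × (Fin M → ℂ)) :
    w ∈ outageEvent M K R PS N μ ↔ portSNR PS N μ w ∈ partialSumsLE M K ((2 : ℝ) ^ R - 1) := by
  have key (S : Finset (Fin M)) : Real.logb 2 (1 + ∑ m ∈ S, portSNR PS N μ w m) ≤ R ↔
      ∑ m ∈ S, portSNR PS N μ w m ≤ (2 : ℝ) ^ R - 1 := by
    have : 0 ≤ ∑ m ∈ S, portSNR PS N μ w m :=
      Finset.sum_nonneg fun m _ => by unfold portSNR; positivity
    rw [Real.logb_le_iff_le_rpow one_lt_two (by linarith), le_sub_iff_add_le, add_comm]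
  constructor
  · rintro ⟨S, hS, h⟩
    exact (mem_partialSumsLE_iff_of_isKMax hS).2 ((key S).1 h)
  · intro h
    obtain ⟨S, hS⟩ := exists_isKMax K hKM (portSNR PS N μ w)
    exact ⟨S, hS, (key S).2 (h S hS.1)⟩

/-- The normalized channel vectors in outage. -/
def outageRegion (M K : ℕ) : Set (Fin M → ℂ) :=
  {v | (fun m => ‖v m‖ ^ 2) ∈ partialSumsLE M K 1}

theorem isClosed_outageRegion (M K : ℕ) : IsClosed (outageRegion M K) :=
  (isClosed_partialSumsLE M K 1).preimage (by fun_prop)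

/-- Each index lies in some `K`-element set because `1 ≤ K ≤ M`, so every coordinate has norm at
most 1. -/
theorem volume_outageRegion_lt_top {M K : ℕ} (hK : 1 ≤ K) (hKM : K ≤ M) :
    volume (outageRegion M K) < ⊤ := by
  refine (measure_mono fun v hv => ?_).trans_lt
    (measure_closedBall_lt_top (x := (0 : Fin M → ℂ)) (r := 1))
  rw [mem_closedBall_zero_iff, pi_norm_le_iff_of_nonneg zero_le_one]
  intro i
  obtain ⟨S, hiS, -, hS⟩ := Finset.exists_subsuperset_card_eq (Finset.subset_univ {i})
    (by simpa using hK) (by simpa using hKM)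
  have h1 := Finset.single_le_sum (f := fun m => ‖v m‖ ^ 2) (fun m _ => by positivity)
    (hiS (Finset.mem_singleton_self i))
  have h2 := h1.trans (hv S hS)
  exact (sq_le_one_iff₀ (norm_nonneg _)).1 h2

/-- The region contains the open Euclidean unit ball. -/
theorem volume_outageRegion_pos (M K : ℕ) : 0 < volume (outageRegion M K) := by
  have ho : IsOpen {v : Fin M → ℂ | ∑ m, ‖v m‖ ^ 2 < 1} := isOpen_lt (by fun_prop) (by fun_prop)
  refine (ho.measure_pos volume ⟨0, by simp⟩).trans_le (measure_mono fun v hv S _ => ?_)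
  exact (Finset.sum_le_univ_sum_of_nonneg fun m => by positivity).trans (le_of_lt hv)

/-! ### Exact integral formula for the outage probability -/

/-- The exponential part of the joint density of reference channel and port channels, at
SNR `l`, as a function of the standardized reference channel and the normalized ports. -/
noncomputable def densityKernel {M : ℕ} (μ l : ℝ) (p : ℂ × (Fin M → ℂ)) : ℝ :=
  Real.exp (-(∑ i, ‖((Real.sqrt l)⁻¹ : ℂ) * p.2 i - (Real.sqrt μ : ℂ) * p.1‖ ^ 2) / (1 - μ))

theorem densityKernel_nonneg {M : ℕ} (μ l : ℝ) (p : ℂ × (Fin M → ℂ)) :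
    0 ≤ densityKernel μ l p :=
  (Real.exp_pos _).le

theorem densityKernel_le_one {M : ℕ} {μ : ℝ} (hμ : μ < 1) (l : ℝ) (p : ℂ × (Fin M → ℂ)) :
    densityKernel μ l p ≤ 1 := by
  rw [densityKernel, Real.exp_le_one_iff]
  exact div_nonpos_of_nonpos_of_nonneg
    (neg_nonpos.2 (Finset.sum_nonneg fun i _ => by positivity)) (by linarith)

theorem continuous_densityKernel {M : ℕ} (μ l : ℝ) :
    Continuous (densityKernel (M := M) μ l) := by
  unfold densityKernel; fun_prop

theorem prod_complexGaussianDensity {M : ℕ} {μ l : ℝ} (hl : 0 < l)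
    (p : ℂ × (Fin M → ℂ)) :
    ∏ i, complexGaussianDensity ((Real.sqrt l : ℂ) * ((Real.sqrt μ : ℂ) * p.1)) (l * (1 - μ))
        (p.2 i)
      = ((Real.pi * (l * (1 - μ))) ^ M)⁻¹ * densityKernel μ l p := by
  simp only [complexGaussianDensity, densityKernel]
  rw [Finset.prod_mul_distrib, Finset.prod_const, Finset.card_univ, Fintype.card_fin, inv_pow,
    ← Real.exp_sum, ← Finset.sum_neg_distrib, Finset.sum_div]
  congr 2
  refine Finset.sum_congr rfl fun i _ => ?_
  have hs : Real.sqrt l ≠ 0 := (Real.sqrt_pos.2 hl).ne'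
  have hs' : (Real.sqrt l : ℂ) ≠ 0 := by exact_mod_cast hs
  have : p.2 i - (Real.sqrt l : ℂ) * ((Real.sqrt μ : ℂ) * p.1) =
      (Real.sqrt l : ℂ) * (((Real.sqrt l)⁻¹ : ℂ) * p.2 i - (Real.sqrt μ : ℂ) * p.1) := by
    rw [mul_sub, mul_inv_cancel_left₀ hs']
  rw [this, norm_mul, mul_pow, Complex.norm_real, Real.norm_eq_abs, sq_abs, Real.sq_sqrt hl.le,
    ← mul_neg, mul_div_mul_left _ _ hl.ne']

theorem outageProb_eq_integral {M K : ℕ} (hK : 1 ≤ K) (hKM : K ≤ M) {R PS α N μ : ℝ} (hR : 0 < R)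
    (hμ1 : μ < 1) (hPS : 0 < PS) (hα : 0 < α) (hN : 0 < N) {l : ℝ}
    (hl : l = avgSNR PS α N / ((2 : ℝ) ^ R - 1)) :
    outageProb M K R PS α N μ = ((Real.pi * (l * (1 - μ))) ^ M)⁻¹ *
      ∫ p, densityKernel μ l p
        ∂((complexGaussian 1).prod (volume.restrict (outageRegion M K))) := by
  have hz : 0 < (2 : ℝ) ^ R - 1 := sub_pos.2 (Real.one_lt_rpow one_lt_two hR)
  set z := (2 : ℝ) ^ R - 1
  have hl0 : 0 < l := by rw [hl, avgSNR]; positivity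
  have hμ' : 0 < 1 - μ := sub_pos.2 hμ1
  -- This scale gives `‖c h_m‖ ^ 2 = γ_m / z`, so the threshold `z` becomes 1.
  set c := Real.sqrt (PS / (N * z)) with hc
  have hc0 : 0 < c := Real.sqrt_pos.2 (by positivity)
  have hA := (isClosed_outageRegion M K).measurableSet
  have hev : outageEvent M K R PS N μ =
      (fun w : ℂ × (Fin M → ℂ) => fun i => (c : ℂ) * portChannel μ w i) ⁻¹' outageRegion M K := by
    ext w
    rw [mem_outageEvent_iff hKM hPS hN]
    refine forall_congr' fun S => forall_congr' fun _ => ?_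
    have : ∑ m ∈ S, ‖(c : ℂ) * portChannel μ w m‖ ^ 2 = (∑ m ∈ S, portSNR PS N μ w m) / z := by
      rw [Finset.sum_div]
      refine Finset.sum_congr rfl fun m _ => ?_
      rw [norm_mul, mul_pow, Complex.norm_real, Real.norm_eq_abs, sq_abs, hc,
        Real.sq_sqrt (by positivity), portSNR]
      field_simp
    rw [this, div_le_one hz]
  have hcont : Continuous
      (fun w : ℂ × (Fin M → ℂ) => fun i => (c : ℂ) * portChannel μ w i) := by
    unfold portChannel; fun_prop
  have hmeas : MeasurableSet (outageEvent M K R PS N μ) := by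
    rw [hev]; exact hcont.measurable hA
  have hcl : c * Real.sqrt α = Real.sqrt l := by
    rw [hc, ← Real.sqrt_mul (by positivity), hl, avgSNR]
    congr 1
    field_simp
  have hvar : (c * Real.sqrt (1 - μ)) ^ 2 * α = l * (1 - μ) := by
    rw [mul_pow, Real.sq_sqrt hμ'.le, ← Real.sq_sqrt hl0.le, ← hcl, mul_pow, Real.sq_sqrt hα.le]
    ring
  have : IsFiniteMeasure ((volume : Measure (Fin M → ℂ)).restrict (outageRegion M K)) :=
    ⟨by simpa using volume_outageRegion_lt_top hK hKM⟩
  have hkm : Measurable (fun p : ℂ × (Fin M → ℂ) => ENNReal.ofReal (densityKernel μ l p)) :=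
    (continuous_densityKernel μ l).measurable.ennreal_ofReal
  have main : channelLaw M α (outageEvent M K R PS N μ) =
      ENNReal.ofReal ((Real.pi * (l * (1 - μ))) ^ M)⁻¹ * ∫⁻ p, ENNReal.ofReal (densityKernel μ l p)
        ∂((complexGaussian 1).prod (volume.restrict (outageRegion M K))) := by
    rw [channelLaw, Measure.prod_apply hmeas, lintegral_prod _ hkm.aemeasurable,
      ← lintegral_const_mul' _ _ ENNReal.ofReal_ne_top]
    -- Writing `h₀ = √α g` with `g` standard makes the integrating measure independent of the SNR.
    have hscale (f : ℂ → ENNReal) (hf : Measurable f) : ∫⁻ h, f h ∂(complexGaussian α) =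
        ∫⁻ g, f ((Real.sqrt α : ℂ) * g) ∂(complexGaussian 1) := by
      rw [complexGaussian_eq_map hα, lintegral_map hf (by fun_prop)]
    rw [hscale _ (measurable_measure_prodMk_left hmeas)]
    refine lintegral_congr fun g => ?_
    have hset : Prod.mk ((Real.sqrt α : ℂ) * g) ⁻¹' outageEvent M K R PS N μ =
        (fun (e : Fin M → ℂ) i => (Real.sqrt l : ℂ) * ((Real.sqrt μ : ℂ) * g) +
          ((c * Real.sqrt (1 - μ) : ℝ) : ℂ) * e i) ⁻¹' outageRegion M K := by
      rw [hev, ← hcl]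
      ext e
      simp only [Set.mem_preimage, portChannel]
      refine iff_of_eq (congrArg (· ∈ outageRegion M K) (funext fun i => ?_))
      push_cast
      ring
    rw [hset, ← Measure.map_apply (by fun_prop) hA, pi_complexGaussian_map_affine M _
      (mul_pos hc0 (Real.sqrt_pos.2 hμ')) hα, withDensity_apply _ hA, hvar,
      ← lintegral_const_mul' _ _ ENNReal.ofReal_ne_top]
    refine lintegral_congr fun v => ?_
    rw [prod_complexGaussianDensity hl0 (g, v), ENNReal.ofReal_mul (by positivity)]
  rw [outageProb, measureReal_def, main, ENNReal.toReal_mul, ENNReal.toReal_ofReal (by positivity),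
    integral_eq_lintegral_of_nonneg_ae (Eventually.of_forall fun p => densityKernel_nonneg μ l p)
      (continuous_densityKernel μ l).aestronglyMeasurable]

/-! ### The high-SNR limit -/

theorem integral_exp_neg_mul_sq_norm_complexGaussian {b : ℝ} (hb : 0 ≤ b) :
    ∫ g, Real.exp (-b * ‖g‖ ^ 2) ∂(complexGaussian 1) = (1 + b)⁻¹ := by
  rw [complexGaussian_eq_withDensity one_pos, integral_withDensity_eq_integral_toReal_smul
    (continuous_complexGaussianDensity _ _).measurable.ennreal_ofReal
    (Eventually.of_forall fun _ => ENNReal.ofReal_lt_top)]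
  have : ∀ g : ℂ, (ENNReal.ofReal (complexGaussianDensity 0 1 g)).toReal •
      Real.exp (-b * ‖g‖ ^ 2) = Real.pi⁻¹ * Real.exp (-(1 + b) * ‖g‖ ^ 2) := fun g => by
    rw [ENNReal.toReal_ofReal (complexGaussianDensity_nonneg _ one_pos _), complexGaussianDensity,
      smul_eq_mul, mul_one, mul_assoc, ← Real.exp_add]
    congr 2
    rw [sub_zero]; ring
  simp_rw [this]
  rw [integral_const_mul, GaussianFourier.integral_rexp_neg_mul_sq_norm (by linarith),
    Complex.finrank_real_complex]
  norm_num
  field_simp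

theorem tendsto_integral_densityKernel {M K : ℕ} (hK : 1 ≤ K) (hKM : K ≤ M) {μ : ℝ}
    (hμ0 : 0 ≤ μ) (hμ1 : μ < 1) :
    Tendsto (fun l => ∫ p, densityKernel μ l p
        ∂((complexGaussian 1).prod (volume.restrict (outageRegion M K)))) atTop
      (𝓝 (volume.real (outageRegion M K) * ((1 - μ) / (M * μ + 1 - μ)))) := by
  have hμ' : 0 < 1 - μ := sub_pos.2 hμ1
  have : IsFiniteMeasure ((volume : Measure (Fin M → ℂ)).restrict (outageRegion M K)) :=
    ⟨by simpa using volume_outageRegion_lt_top hK hKM⟩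
  have hb : 0 ≤ M * μ / (1 - μ) := by positivity
  have hlim : ∫ p : ℂ × (Fin M → ℂ), Real.exp (-(M * μ / (1 - μ)) * ‖p.1‖ ^ 2)
        ∂((complexGaussian 1).prod (volume.restrict (outageRegion M K))) =
      volume.real (outageRegion M K) * ((1 - μ) / (M * μ + 1 - μ)) := by
    rw [integral_fun_fst (fun g : ℂ => Real.exp (-(M * μ / (1 - μ)) * ‖g‖ ^ 2)),
      integral_exp_neg_mul_sq_norm_complexGaussian hb, smul_eq_mul]
    have h1 : (0 : ℝ) < M * μ + 1 - μ := by
      have : 0 ≤ (M : ℝ) * μ := by positivity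
      linarith
    congr 1
    · simp [measureReal_def]
    · rw [inv_eq_iff_eq_inv, inv_div]
      field_simp
      ring
  rw [← hlim]
  refine tendsto_integral_filter_of_dominated_convergence (fun _ => 1)
    (Eventually.of_forall fun l => (continuous_densityKernel μ l).aestronglyMeasurable)
    (Eventually.of_forall fun l => Eventually.of_forall fun p => ?_) (integrable_const _)
    (Eventually.of_forall fun p => ?_)
  · rw [Real.norm_eq_abs, densityKernel, Real.abs_exp]
    exact densityKernel_le_one hμ1 l p
  -- The kernel depends on `l` only through `t = 1 / √l`, and continuously in `t`; the limit is its
  -- value at `t = 0`.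
  · have h0 : Tendsto (fun l : ℝ => ((Real.sqrt l)⁻¹ : ℂ)) atTop (𝓝 0) := by
      have := (Complex.continuous_ofReal.tendsto 0).comp
        (tendsto_inv_atTop_zero.comp Real.tendsto_sqrt_atTop)
      simpa [Function.comp_def] using this
    have hcont : Continuous fun t : ℂ => Real.exp
        (-(∑ i, ‖t * p.2 i - (Real.sqrt μ : ℂ) * p.1‖ ^ 2) / (1 - μ)) := by fun_prop
    have h := (hcont.tendsto 0).comp h0
    have he : Real.exp (-(∑ i, ‖0 * p.2 i - (Real.sqrt μ : ℂ) * p.1‖ ^ 2) / (1 - μ)) =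
        Real.exp (-(M * μ / (1 - μ)) * ‖p.1‖ ^ 2) := by
      congr 1
      simp [mul_pow, Real.sq_sqrt hμ0]
      ring
    rw [he] at h
    exact h

/-! ### From complex volume to nonnegative coordinates -/

/-- Lebesgue measure on `[0, ∞)`. -/
noncomputable def halfLineVolume : Measure ℝ := volume.restrict (Set.Ici 0)

instance : SigmaFinite halfLineVolume := by unfold halfLineVolume; infer_instance

/-- For `b ≥ 0`, the set where `π |w|² ≤ b` is a disc of area `b`; differences of such areas give
the measure of half-open intervals, which determine it. -/
theorem map_pi_mul_sq_norm_volume :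
    (volume : Measure ℂ).map (fun w => Real.pi * ‖w‖ ^ 2) = halfLineVolume := by
  have hm : Measurable fun w : ℂ => Real.pi * ‖w‖ ^ 2 := by fun_prop
  have hball (b : ℝ) : volume {w : ℂ | Real.pi * ‖w‖ ^ 2 ≤ b} = ENNReal.ofReal b := by
    rcases lt_or_ge b 0 with hb | hb
    · rw [ENNReal.ofReal_of_nonpos hb.le]
      convert measure_empty (μ := (volume : Measure ℂ))
      ext w
      simp only [Set.mem_ofPred_eq, Set.mem_empty_iff_false, iff_false, not_le]
      exact hb.trans_le (by positivity)
    · have : {w : ℂ | Real.pi * ‖w‖ ^ 2 ≤ b} = Metric.closedBall 0 (Real.sqrt (b / Real.pi)) := by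
        ext w
        rw [mem_closedBall_zero_iff, Real.le_sqrt (norm_nonneg _) (by positivity),
          le_div_iff₀ Real.pi_pos, mul_comm]
        rfl
      rw [this, Complex.volume_closedBall, ← ENNReal.ofReal_pow (Real.sqrt_nonneg _),
        Real.sq_sqrt (by positivity)]
      have hp : (NNReal.pi : ENNReal) = ENNReal.ofReal Real.pi := by
        rw [← NNReal.coe_real_pi, ENNReal.ofReal_coe_nnreal]
      rw [hp, ← ENNReal.ofReal_mul (by positivity), div_mul_cancel₀ _ Real.pi_pos.ne']
  have key (a b : ℝ) (hab : a < b) :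
      (volume : Measure ℂ).map (fun w => Real.pi * ‖w‖ ^ 2) (Set.Ioc a b) =
        ENNReal.ofReal b - ENNReal.ofReal a := by
    have hset : (fun w : ℂ => Real.pi * ‖w‖ ^ 2) ⁻¹' Set.Ioc a b =
        {w : ℂ | Real.pi * ‖w‖ ^ 2 ≤ b} \ {w : ℂ | Real.pi * ‖w‖ ^ 2 ≤ a} := by
      ext w; simp [and_comm]
    have hsub : {w : ℂ | Real.pi * ‖w‖ ^ 2 ≤ a} ⊆ {w : ℂ | Real.pi * ‖w‖ ^ 2 ≤ b} :=
      fun w hw => le_trans hw hab.le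
    have hfin : volume {w : ℂ | Real.pi * ‖w‖ ^ 2 ≤ a} ≠ ⊤ := by
      rw [hball]; exact ENNReal.ofReal_ne_top
    rw [Measure.map_apply hm measurableSet_Ioc, hset,
      measure_sdiff hsub (measurableSet_le hm measurable_const).nullMeasurableSet hfin,
      hball, hball]
  refine Measure.ext_of_Ioc' _ _ (fun a b hab => ?_) fun a b hab => ?_
  · rw [key a b hab]
    exact (tsub_le_self.trans_lt ENNReal.ofReal_lt_top).ne
  · rw [key a b hab, halfLineVolume, Measure.restrict_apply measurableSet_Ioc]
    rcases lt_or_ge a 0 with ha | ha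
    · have : Set.Ioc a b ∩ Set.Ici 0 = Set.Icc 0 b := by
        ext x; simp only [Set.mem_inter_iff, Set.mem_Ioc, Set.mem_Ici, Set.mem_Icc]
        constructor
        · rintro ⟨⟨_, h⟩, h'⟩; exact ⟨h', h⟩
        · rintro ⟨h, h'⟩; exact ⟨⟨ha.trans_le h, h'⟩, h⟩
      rw [this, Real.volume_Icc, ENNReal.ofReal_of_nonpos ha.le, tsub_zero, sub_zero]
    · have : Set.Ioc a b ∩ Set.Ici 0 = Set.Ioc a b :=
        Set.inter_eq_left.2 fun x hx => ha.trans hx.1.le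
      rw [this, Real.volume_Ioc, ENNReal.ofReal_sub _ ha]

theorem pi_halfLineVolume_apply {ι : Type*} [Fintype ι] {B : Set (ι → ℝ)} (hB : MeasurableSet B) :
    Measure.pi (fun _ : ι => halfLineVolume) B =
      volume {v : ι → ℂ | (fun i => Real.pi * ‖v i‖ ^ 2) ∈ B} := by
  have : ∀ i : ι, SigmaFinite ((volume : Measure ℂ).map fun w => Real.pi * ‖w‖ ^ 2) := fun _ => by
    rw [map_pi_mul_sq_norm_volume]; infer_instance
  have h := Measure.pi_map_pi (μ := fun _ : ι => (volume : Measure ℂ)) (hμ := this)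
    (f := fun (_ : ι) (w : ℂ) => Real.pi * ‖w‖ ^ 2) (fun _ => by fun_prop)
  simp only [map_pi_mul_sq_norm_volume] at h
  rw [← h, Measure.map_apply (by fun_prop) hB]
  rfl

theorem pi_halfLineVolume_eq_restrict {ι : Type*} [Fintype ι] :
    Measure.pi (fun _ : ι => halfLineVolume) =
      volume.restrict (Set.univ.pi fun _ : ι => Set.Ici (0 : ℝ)) := by
  rw [volume_pi, Measure.restrict_pi_pi]; rfl

/-- Pulled back to `ι → ℂ`, the simplex is a Euclidean ball, whose known volume supplies the
factorial. -/
theorem pi_halfLineVolume_simplex {ι : Type*} [Fintype ι] [Nonempty ι] (r : ℝ) :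
    Measure.pi (fun _ : ι => halfLineVolume) {x | ∑ i, x i ≤ r} =
      ENNReal.ofReal r ^ Fintype.card ι / ((Fintype.card ι).factorial : ENNReal) := by
  rw [pi_halfLineVolume_apply (measurableSet_le (by fun_prop) measurable_const)]
  rcases lt_or_ge r 0 with hr | hr
  · rw [ENNReal.ofReal_of_nonpos hr.le, zero_pow Fintype.card_ne_zero, ENNReal.zero_div]
    convert measure_empty (μ := (volume : Measure (ι → ℂ)))
    ext v
    simp only [Set.mem_ofPred_eq, Set.mem_empty_iff_false, iff_false, not_le]
    exact hr.trans_le (Finset.sum_nonneg fun i _ => by positivity)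
  have hset : {v : ι → ℂ | (fun i => Real.pi * ‖v i‖ ^ 2) ∈ {x : ι → ℝ | ∑ i, x i ≤ r}} =
      {v : ι → ℂ | (∑ i, ‖v i‖ ^ (2 : ℝ)) ^ (1 / (2 : ℝ)) ≤ Real.sqrt (r / Real.pi)} := by
    ext v
    simp only [Set.mem_ofPred_eq, Real.rpow_two, ← Real.sqrt_eq_rpow]
    rw [Real.sqrt_le_sqrt_iff (by positivity), le_div_iff₀ Real.pi_pos, mul_comm, Finset.mul_sum]
  rw [hset, Complex.volume_sum_rpow_le (p := 2) ι one_le_two, pow_mul,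
    ← ENNReal.ofReal_pow (Real.sqrt_nonneg _), Real.sq_sqrt (by positivity)]
  have h1 : (2 : ℝ) * Fintype.card ι / 2 + 1 = (Fintype.card ι : ℝ) + 1 := by ring
  have h2 : (2 : ℝ) / 2 + 1 = 1 + 1 := by norm_num
  have h3 : Real.Gamma (1 + 1) = 1 := by
    simpa using Real.Gamma_nat_eq_factorial 1
  rw [h1, h2, h3, Real.Gamma_nat_eq_factorial, mul_one, ← ENNReal.ofReal_pow (by positivity),
    ← ENNReal.ofReal_mul (by positivity), ← mul_div_assoc, ← mul_pow,
    div_mul_cancel₀ _ Real.pi_pos.ne', ENNReal.ofReal_div_of_pos (by positivity),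
    ENNReal.ofReal_pow hr, ENNReal.ofReal_natCast]

/-- Translation by `t` in each coordinate reduces this to the full simplex. -/
theorem pi_halfLineVolume_truncated_simplex {ι : Type*} [Fintype ι] [Nonempty ι] (r : ℝ) {t : ℝ}
    (ht : 0 ≤ t) :
    Measure.pi (fun _ : ι => halfLineVolume) {x | (∀ i, t ≤ x i) ∧ ∑ i, x i ≤ r} =
      ENNReal.ofReal (r - Fintype.card ι * t) ^ Fintype.card ι /
        ((Fintype.card ι).factorial : ENNReal) := by
  have hm1 : MeasurableSet {x : ι → ℝ | (∀ i, t ≤ x i) ∧ ∑ i, x i ≤ r} :=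
    (isClosed_Ici (a := fun _ : ι => t)).measurableSet.inter
      (measurableSet_le (f := fun x : ι → ℝ => ∑ i, x i) (by fun_prop) measurable_const)
  have hm2 (a : ℝ) : MeasurableSet {x : ι → ℝ | ∑ i, x i ≤ a} :=
    measurableSet_le (by fun_prop) measurable_const
  rw [← pi_halfLineVolume_simplex, pi_halfLineVolume_eq_restrict, Measure.restrict_apply hm1,
    Measure.restrict_apply (hm2 _), ← measure_preimage_add_right volume (fun _ : ι => t)]
  congr 1
  ext x
  simp only [Set.mem_preimage, Set.mem_inter_iff, Set.mem_ofPred_eq, Set.mem_univ_pi,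
    Set.mem_Ici, Pi.add_apply, Finset.sum_add_distrib, Finset.sum_const, Finset.card_univ,
    nsmul_eq_mul, le_add_iff_nonneg_left]
  constructor
  · rintro ⟨⟨h1, h2⟩, -⟩
    exact ⟨by linarith, h1⟩
  · rintro ⟨h1, h2⟩
    exact ⟨⟨h2, by linarith⟩, fun i => add_nonneg (h2 i) ht⟩

theorem pi_halfLineVolume_coord_lt {ι : Type*} [Fintype ι] (t : ℝ) :
    Measure.pi (fun _ : ι => halfLineVolume) {x | ∀ i, x i < t} =
      ENNReal.ofReal t ^ Fintype.card ι := by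
  have : {x : ι → ℝ | ∀ i, x i < t} = Set.univ.pi fun _ => Set.Iio t := by ext; simp
  have h2 : Set.Iio t ∩ Set.Ici 0 = Set.Ico 0 t := by ext; simp [and_comm]
  rw [this, Measure.pi_pi, Finset.prod_const, Finset.card_univ, halfLineVolume,
    Measure.restrict_apply measurableSet_Iio, h2, Real.volume_Ico, sub_zero]

/-- Binomial expansion and termwise integration; this is the source of the alternating sum in `psi`.
-/
theorem integral_sub_pow_mul_pow {K n : ℕ} (hK : 1 ≤ K) (hn : 1 ≤ n) {r : ℝ} (hr : 0 < r) :
    ∫ t in (0 : ℝ)..(r / K), (r - K * t) ^ K * t ^ (n - 1) =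
      r ^ (K + n) / (K : ℝ) ^ n *
        ∑ k ∈ Finset.range (K + 1), (-1 : ℝ) ^ k * (K.choose k : ℝ) / ((k : ℝ) + n) := by
  have hK0 : (K : ℝ) ≠ 0 := by positivity
  have hexp (t : ℝ) : (r - K * t) ^ K * t ^ (n - 1) = ∑ k ∈ Finset.range (K + 1),
      ((-1) ^ k * (K : ℝ) ^ k * r ^ (K - k) * (K.choose k : ℝ)) * t ^ (k + n - 1) := by
    have : r - K * t = (-1 * K * t) + r := by ring
    rw [this, add_pow, Finset.sum_mul]
    refine Finset.sum_congr rfl fun k _ => ?_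
    rw [mul_pow, mul_pow, Nat.add_sub_assoc hn, pow_add]
    ring
  simp_rw [hexp]
  rw [intervalIntegral.integral_finsetSum fun k _ =>
    (Continuous.intervalIntegrable (by fun_prop) _ _), Finset.mul_sum]
  refine Finset.sum_congr rfl fun k hk => ?_
  have hkK : k ≤ K := Nat.lt_succ_iff.1 (Finset.mem_range.1 hk)
  have h1 : k + n - 1 + 1 = k + n := by omega
  have h2 : ((k + n - 1 : ℕ) : ℝ) + 1 = (k : ℝ) + n := by
    exact_mod_cast congrArg (Nat.cast (R := ℝ)) h1
  have h3 : r ^ (K + n) = r ^ (K - k) * r ^ (k + n) := by rw [← pow_add]; congr 1; omega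
  have h4 : (k : ℝ) + n ≠ 0 := by positivity
  rw [intervalIntegral.integral_const_mul, integral_pow, h1, h2, zero_pow (by omega), sub_zero,
    div_pow, h3, pow_add (K : ℝ) k n]
  field_simp

/-! ### Splitting by the set of largest coordinates -/

/-- The vectors whose `S`-coordinates exceed all others and have sum at most `r`. -/
def topCell {M : ℕ} (S : Finset (Fin M)) (r : ℝ) : Set (Fin M → ℝ) :=
  {x | (∀ i ∈ S, ∀ j ∉ S, x j < x i) ∧ ∑ i ∈ S, x i ≤ r}

theorem measurableSet_topCell {M : ℕ} (S : Finset (Fin M)) (r : ℝ) :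
    MeasurableSet (topCell S r) := by
  have : topCell S r = (⋂ i ∈ S, ⋂ j ∈ Sᶜ, {x | x j < x i}) ∩ {x | ∑ i ∈ S, x i ≤ r} := by
    ext x; simp [topCell]
  rw [this]
  refine MeasurableSet.inter ?_ (measurableSet_le (by fun_prop) measurable_const)
  exact Finset.measurableSet_biInter _ fun i _ => Finset.measurableSet_biInter _ fun j _ =>
    measurableSet_lt (measurable_pi_apply j) (measurable_pi_apply i)

theorem pi_halfLineVolume_ae_nonneg {ι : Type*} [Fintype ι] :
    ∀ᵐ x ∂(Measure.pi fun _ : ι => halfLineVolume), ∀ i, 0 ≤ x i := by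
  rw [pi_halfLineVolume_eq_restrict]
  filter_upwards [ae_restrict_mem (MeasurableSet.univ_pi fun _ => measurableSet_Ici)] with x hx i
  exact hx i (Set.mem_univ i)

/-- Each tie `x i = x j` confines `x` to a proper subspace, which is null. -/
theorem pi_halfLineVolume_ae_injective {ι : Type*} [Fintype ι] :
    ∀ᵐ x ∂(Measure.pi fun _ : ι => halfLineVolume), Function.Injective x := by
  have key (i j : ι) (hij : i ≠ j) :
      ∀ᵐ x ∂(Measure.pi fun _ : ι => halfLineVolume), x i ≠ x j := by
    rw [pi_halfLineVolume_eq_restrict]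
    refine ae_restrict_of_ae ?_
    set L : (ι → ℝ) →ₗ[ℝ] ℝ :=
      LinearMap.proj (R := ℝ) (φ := fun _ => ℝ) i - LinearMap.proj (R := ℝ) (φ := fun _ => ℝ) j
    have hL : LinearMap.ker L ≠ ⊤ := by
      classical
      intro h
      have h1 : Pi.single i (1 : ℝ) ∈ LinearMap.ker L := by rw [h]; trivial
      rw [LinearMap.mem_ker] at h1
      simp [L, hij.symm] at h1
    have h0 := Measure.addHaar_submodule volume _ hL
    refine measure_mono_null (fun x hx => ?_) h0
    simp only [ne_eq, Set.mem_compl_iff, Set.mem_ofPred_eq, not_not] at hx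
    simp [L, hx]
  have hall : ∀ᵐ x ∂(Measure.pi fun _ : ι => halfLineVolume), ∀ i j, i ≠ j → x i ≠ x j := by
    simp only [ae_all_iff]
    exact key
  filter_upwards [hall] with x hx i j h
  by_contra hij
  exact hx i j hij h

/-- Fubini: with the `S`-coordinates fixed, the other `M - S.card` coordinates range independently
between 0 and their minimum. -/
theorem pi_halfLineVolume_topCell_eq_lintegral {M : ℕ} (S : Finset (Fin M)) [Nonempty S] (r : ℝ) :
    Measure.pi (fun _ : Fin M => halfLineVolume) (topCell S r) =
      ∫⁻ y in {y : S → ℝ | ∑ i, y i ≤ r},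
        ENNReal.ofReal (Finset.univ.inf' Finset.univ_nonempty y) ^ (M - S.card)
          ∂(Measure.pi fun _ => halfLineVolume) := by
  set E : Set ((S → ℝ) × ({i : Fin M // i ∉ S} → ℝ)) :=
    {p | (∀ i j, p.2 j < p.1 i) ∧ ∑ i, p.1 i ≤ r} with hE
  have hEm : MeasurableSet E := by
    have : E = (⋂ i, ⋂ j, {p | p.2 j < p.1 i}) ∩ {p | ∑ i, p.1 i ≤ r} := by
      ext p; simp [hE]
    rw [this]
    exact (MeasurableSet.iInter fun i => MeasurableSet.iInter fun j =>
      measurableSet_lt (by fun_prop) (by fun_prop)).inter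
        (measurableSet_le (by fun_prop) measurable_const)
  have hpre : topCell S r =
      MeasurableEquiv.piEquivPiSubtypeProd (fun _ : Fin M => ℝ) (· ∈ S) ⁻¹' E := by
    ext x
    simp only [topCell, hE, Set.mem_preimage, Set.mem_ofPred_eq,
      MeasurableEquiv.piEquivPiSubtypeProd, MeasurableEquiv.coe_mk,
      Equiv.piEquivPiSubtypeProd_apply, Subtype.forall]
    rw [Finset.sum_coe_sort S x]
  have hprod : Measure.pi (fun _ : Fin M => halfLineVolume) (topCell S r) =
      ((Measure.pi fun _ : S => halfLineVolume).prod (Measure.pi fun _ => halfLineVolume)) E := by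
    rw [hpre]
    convert (measurePreserving_piEquivPiSubtypeProd (fun _ : Fin M => halfLineVolume)
      (· ∈ S)).measure_preimage hEm.nullMeasurableSet
  rw [hprod, Measure.prod_apply hEm,
    ← lintegral_indicator (measurableSet_le (by fun_prop) measurable_const)]
  refine lintegral_congr fun y => ?_
  by_cases hy : ∑ i, y i ≤ r
  · rw [Set.indicator_of_mem (by exact hy)]
    have : Prod.mk y ⁻¹' E = {w : {i : Fin M // i ∉ S} → ℝ |
        ∀ j, w j < Finset.univ.inf' Finset.univ_nonempty y} := by
      ext w
      simp only [hE, Set.mem_preimage, Set.mem_ofPred_eq, hy, and_true, Finset.lt_inf'_iff,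
        Finset.mem_univ, true_imp_iff]
      exact forall_comm
    rw [this, pi_halfLineVolume_coord_lt]
    congr 1
    rw [Fintype.card_subtype_compl, Fintype.card_fin, Fintype.card_coe]
  · rw [Set.indicator_of_notMem (by exact hy)]
    have : Prod.mk y ⁻¹' E = ∅ :=
      Set.eq_empty_of_forall_notMem fun w hw => hy hw.2
    rw [this, measure_empty]

theorem pi_halfLineVolume_topCell {M K : ℕ} (hK : 1 ≤ K) (hKM : K < M) {S : Finset (Fin M)}
    (hS : S.card = K) {r : ℝ} (hr : 0 < r) :
    Measure.pi (fun _ : Fin M => halfLineVolume) (topCell S r) =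
      ENNReal.ofReal (((M - K : ℕ) : ℝ) / K.factorial *
        ∫ t in (0 : ℝ)..(r / K), (r - K * t) ^ K * t ^ (M - K - 1)) := by
  have hne : Nonempty S := by
    rw [Finset.nonempty_coe_sort, ← Finset.card_pos]; omega
  have hK0 : (0 : ℝ) < K := by positivity
  obtain ⟨n, hn⟩ : ∃ n, M - K = n + 1 := ⟨M - K - 1, by omega⟩
  rw [pi_halfLineVolume_topCell_eq_lintegral, hS, hn, Nat.add_sub_cancel]
  set f : (S → ℝ) → ℝ := fun y => Finset.univ.inf' Finset.univ_nonempty y with hf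
  have hfc : Continuous f := Continuous.finset_inf'_apply _ fun i _ => continuous_apply i
  have hf0 : 0 ≤ᵐ[(Measure.pi fun _ : S => halfLineVolume).restrict {y | ∑ i, y i ≤ r}] f := by
    refine ae_restrict_of_ae ?_
    filter_upwards [pi_halfLineVolume_ae_nonneg] with y hy
    exact (Finset.le_inf'_iff _ _).2 fun i _ => hy i
  have hpow : ∫⁻ y in {y : S → ℝ | ∑ i, y i ≤ r}, ENNReal.ofReal (f y) ^ (n + 1)
        ∂(Measure.pi fun _ => halfLineVolume) =
      ∫⁻ y in {y : S → ℝ | ∑ i, y i ≤ r}, ENNReal.ofReal (f y ^ ((n + 1 : ℕ) : ℝ))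
        ∂(Measure.pi fun _ => halfLineVolume) := by
    refine lintegral_congr_ae ?_
    filter_upwards [hf0] with y hy
    rw [Real.rpow_natCast, ENNReal.ofReal_pow hy]
  -- Layer cake for the power `n + 1` of the minimum: the superlevel set at `t` is a truncated
  -- simplex, weighted by `t ^ n`.
  have hlayer (t : ℝ) (ht : 0 < t) :
      (Measure.pi fun _ : S => halfLineVolume).restrict {y | ∑ i, y i ≤ r} {y | t ≤ f y} *
        ENNReal.ofReal (t ^ (((n + 1 : ℕ) : ℝ) - 1)) =
      ENNReal.ofReal (r - K * t) ^ K / (K.factorial : ENNReal) * ENNReal.ofReal (t ^ n) := by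
    have hset : {y | t ≤ f y} ∩ {y : S → ℝ | ∑ i, y i ≤ r} =
        {y | (∀ i, t ≤ y i) ∧ ∑ i, y i ≤ r} := by
      ext y; simp [hf, Finset.le_inf'_iff]
    rw [Measure.restrict_apply (measurableSet_le measurable_const hfc.measurable), hset,
      pi_halfLineVolume_truncated_simplex r ht.le, Fintype.card_coe, hS]
    congr 2
    rw [← Real.rpow_natCast]
    push_cast
    ring_nf
  have hb : 0 < r / K := by positivity
  -- Beyond `r / K` the truncated simplex has measure zero, as `K` coordinates at least `t` already
  -- sum to more than `r`.
  have hsplit : ∫⁻ t in Set.Ioi (0 : ℝ),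
        ENNReal.ofReal (r - K * t) ^ K / (K.factorial : ENNReal) * ENNReal.ofReal (t ^ n) =
      ∫⁻ t in Set.Ioc 0 (r / K), ENNReal.ofReal
        ((K.factorial : ℝ)⁻¹ * ((r - K * t) ^ K * t ^ n)) := by
    rw [← Set.Ioc_union_Ioi_eq_Ioi hb.le, lintegral_union measurableSet_Ioi
      (Set.Ioc_disjoint_Ioi le_rfl)]
    have hz : ∫⁻ t in Set.Ioi (r / K),
        ENNReal.ofReal (r - K * t) ^ K / (K.factorial : ENNReal) * ENNReal.ofReal (t ^ n) = 0 := by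
      rw [setLIntegral_congr_fun (g := fun _ => 0) measurableSet_Ioi fun t ht => ?_,
        lintegral_zero]
      have : r - K * t ≤ 0 := by
        have := (div_lt_iff₀ hK0).1 (Set.mem_Ioi.1 ht)
        linarith
      simp only [ENNReal.ofReal_of_nonpos this]
      rw [zero_pow (by omega), ENNReal.zero_div, zero_mul]
    rw [hz, add_zero]
    refine setLIntegral_congr_fun measurableSet_Ioc fun t ht => ?_
    have h1 : 0 ≤ r - K * t := by
      have := (le_div_iff₀ hK0).1 ht.2
      linarith
    have h2 : 0 ≤ t := ht.1.le
    rw [ENNReal.ofReal_mul (by positivity), ENNReal.ofReal_mul (by positivity),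
      ENNReal.ofReal_pow h1, ENNReal.ofReal_inv_of_pos (by positivity), ENNReal.ofReal_natCast,
      ENNReal.div_eq_inv_mul, mul_assoc]
  rw [hpow, lintegral_rpow_eq_lintegral_meas_le_mul _ hf0 hfc.aemeasurable (by positivity),
    setLIntegral_congr_fun measurableSet_Ioi fun t ht => hlayer t ht, hsplit,
    ← ofReal_integral_eq_lintegral_ofReal, ← ENNReal.ofReal_mul (by positivity),
    ← intervalIntegral.integral_of_le hb.le, intervalIntegral.integral_const_mul,
    div_eq_mul_inv ((n + 1 : ℕ) : ℝ), mul_assoc]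
  · exact (Continuous.integrableOn_Icc (by fun_prop)).mono_set Set.Ioc_subset_Icc_self
  · filter_upwards [ae_restrict_mem measurableSet_Ioc] with t ht
    have h1 : 0 ≤ r - K * t := by
      have := (le_div_iff₀ hK0).1 ht.2
      linarith
    have h2 : 0 ≤ t := ht.1.le
    simp only [Pi.zero_apply]
    positivity

theorem disjoint_topCell {M : ℕ} {S T : Finset (Fin M)} (hcard : S.card = T.card) (hST : S ≠ T)
    (r : ℝ) : Disjoint (topCell S r) (topCell T r) := by
  have hnot : ¬ S ⊆ T := fun h => hST (Finset.eq_of_subset_of_card_le h hcard.ge)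
  have hnot' : ¬ T ⊆ S := fun h => hST (Finset.eq_of_subset_of_card_le h hcard.le).symm
  obtain ⟨i, hiS, hiT⟩ := Finset.not_subset.1 hnot
  obtain ⟨j, hjT, hjS⟩ := Finset.not_subset.1 hnot'
  rw [Set.disjoint_left]
  intro x hx hx'
  exact lt_asymm (hx.1 i hiS j hjS) (hx'.1 j hjT i hiT)

/-- Without ties the set of `K` largest coordinates is strictly separated from the rest, and its sum
is the only binding constraint. -/
theorem partialSumsLE_ae_eq_iUnion {M K : ℕ} (hKM : K ≤ M) (r : ℝ) :
    partialSumsLE M K r =ᵐ[Measure.pi fun _ : Fin M => halfLineVolume]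
      (⋃ S ∈ Finset.univ.powersetCard K, topCell S r : Set (Fin M → ℝ)) := by
  filter_upwards [pi_halfLineVolume_ae_injective] with x hx
  refine propext (Iff.trans (b := x ∈ partialSumsLE M K r) Iff.rfl (Iff.trans
    (b := x ∈ ⋃ S ∈ Finset.univ.powersetCard K, topCell S r) ?_ Iff.rfl))
  simp only [Set.mem_iUnion, Finset.mem_powersetCard, Finset.subset_univ, true_and, exists_prop]
  constructor
  · intro h
    obtain ⟨S, hS⟩ := exists_isKMax K hKM x
    refine ⟨S, hS.1, fun i hi j hj => (hS.2 i hi j hj).lt_of_ne fun hij => ?_, h S hS.1⟩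
    exact hj (hx hij ▸ hi)
  · rintro ⟨S, hS, hx⟩
    exact (mem_partialSumsLE_iff_of_isKMax ⟨hS, fun i hi j hj => (hx.1 i hi j hj).le⟩).2 hx.2

theorem volume_real_outageRegion {M K : ℕ} (hK : 1 ≤ K) (hKM : K < M) :
    volume.real (outageRegion M K) = Real.pi ^ M * (M.choose K * ((M - K : ℕ) : ℝ) /
      (K.factorial * (K : ℝ) ^ (M - K)) * ∑ k ∈ Finset.range (K + 1),
        (-1 : ℝ) ^ k * (K.choose k : ℝ) / ((k : ℝ) + ((M - K : ℕ) : ℝ))) := by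
  -- Multiplying the constraints by `π` matches `halfLineVolume`; the threshold `r = π` later yields
  -- the factor `π ^ M`.
  have hset : outageRegion M K =
      {v | (fun i => Real.pi * ‖v i‖ ^ 2) ∈ partialSumsLE M K Real.pi} := by
    ext v
    refine forall_congr' fun S => forall_congr' fun _ => ?_
    rw [← Finset.mul_sum, mul_le_iff_le_one_right Real.pi_pos]
  have hsub : K + (M - K) = M := by omega
  have hcell : 0 ≤ ∫ t in (0 : ℝ)..(Real.pi / K), (Real.pi - K * t) ^ K * t ^ (M - K - 1) := by
    refine intervalIntegral.integral_nonneg (by positivity) fun t ht => ?_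
    have h1 := (le_div_iff₀ (by positivity : (0 : ℝ) < K)).1 ht.2
    exact mul_nonneg (pow_nonneg (by linarith) _) (pow_nonneg ht.1 _)
  rw [measureReal_def, hset,
    ← pi_halfLineVolume_apply (isClosed_partialSumsLE M K Real.pi).measurableSet,
    measure_congr (partialSumsLE_ae_eq_iUnion hKM.le Real.pi), measure_biUnion_finset
      (fun S hS T hT hST => disjoint_topCell ((Finset.mem_powersetCard.1 hS).2.trans
        (Finset.mem_powersetCard.1 hT).2.symm) hST _)
      fun S _ => measurableSet_topCell S _,
    Finset.sum_congr rfl fun S hS =>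
      pi_halfLineVolume_topCell hK hKM (Finset.mem_powersetCard.1 hS).2 Real.pi_pos,
    Finset.sum_const, Finset.card_powersetCard, Finset.card_univ, Fintype.card_fin, nsmul_eq_mul,
    ENNReal.toReal_mul, ENNReal.toReal_natCast, ENNReal.toReal_ofReal (by positivity),
    integral_sub_pow_mul_pow hK (by omega) Real.pi_pos, hsub]
  field_simp

/-! ### Asymptotics and diversity order -/

/-- The limiting coefficient of `(z ω) ^ M` in the outage probability. -/
noncomputable def outageCoefficient (M K : ℕ) (μ : ℝ) : ℝ :=
  (Real.pi ^ M)⁻¹ * (volume.real (outageRegion M K) * ((1 - μ) / (M * μ + 1 - μ)))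

theorem outageCoefficient_pos {M K : ℕ} (hK : 1 ≤ K) (hKM : K ≤ M) {μ : ℝ} (hμ0 : 0 ≤ μ)
    (hμ1 : μ < 1) : 0 < outageCoefficient M K μ := by
  have h1 : 0 < volume.real (outageRegion M K) :=
    ENNReal.toReal_pos (volume_outageRegion_pos M K).ne' (volume_outageRegion_lt_top hK hKM).ne
  have h2 : 0 < 1 - μ := sub_pos.2 hμ1
  have h3 : 0 < M * μ + 1 - μ := by
    have : 0 ≤ (M : ℝ) * μ := by positivity
    linarith
  unfold outageCoefficient
  positivity

theorem psi_eq_outageCoefficient {M K : ℕ} (hK : 1 ≤ K) (hKM : K < M) (μ : ℝ) :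
    psi M K μ = outageCoefficient M K μ := by
  have h1 : (Real.pi ^ M : ℝ) ≠ 0 := by positivity
  rw [outageCoefficient, volume_real_outageRegion hK hKM, psi, mul_assoc (Real.pi ^ M),
    inv_mul_cancel_left₀ h1, Nat.cast_sub hKM.le]
  simp only [div_eq_mul_inv, mul_inv]
  ring

theorem isEquivalent_outageProb {M K : ℕ} (hK : 1 ≤ K) (hKM : K ≤ M) {R μ : ℝ} (hR : 0 < R)
    (hμ0 : 0 ≤ μ) (hμ1 : μ < 1) {ι : Type*} {l : Filter ι} {PS α N : ι → ℝ}
    (hPS : ∀ i, 0 < PS i) (hα : ∀ i, 0 < α i) (hN : ∀ i, 0 < N i)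
    (hSNR : Tendsto (fun i => avgSNR (PS i) (α i) (N i)) l atTop) :
    (fun i => outageProb M K R (PS i) (α i) (N i) μ) ~[l]
      (fun i => outageCoefficient M K μ *
        (((2 : ℝ) ^ R - 1) * omega (avgSNR (PS i) (α i) (N i)) μ) ^ M) := by
  have hz : 0 < (2 : ℝ) ^ R - 1 := sub_pos.2 (Real.one_lt_rpow one_lt_two hR)
  have hμ' : 0 < 1 - μ := sub_pos.2 hμ1
  have hlim := ((tendsto_integral_densityKernel hK hKM hμ0 hμ1).comp
    (hSNR.atTop_div_const hz)).const_mul ((Real.pi ^ M)⁻¹ : ℝ)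
  have hequiv := (isEquivalent_const_iff_tendsto (outageCoefficient_pos hK hKM hμ0 hμ1).ne').2 hlim
  refine (hequiv.mul (IsEquivalent.refl (u := fun i =>
    (((2 : ℝ) ^ R - 1) * omega (avgSNR (PS i) (α i) (N i)) μ) ^ M))).congr_left
      (Eventually.of_forall fun i => ?_)
  have hφ : 0 < avgSNR (PS i) (α i) (N i) :=
    div_pos (mul_pos (hPS i) (hα i)) (hN i)
  simp only [Pi.mul_apply, Function.comp_apply, omega]
  rw [outageProb_eq_integral hK hKM hR hμ1 (hPS i) (hα i) (hN i) rfl]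
  have : (Real.pi * (avgSNR (PS i) (α i) (N i) / ((2 : ℝ) ^ R - 1) * (1 - μ)))⁻¹ =
      Real.pi⁻¹ * (((2 : ℝ) ^ R - 1) * (avgSNR (PS i) (α i) (N i) * (1 - μ))⁻¹) := by
    field_simp
  rw [← inv_pow (Real.pi * _), this, mul_pow Real.pi⁻¹, inv_pow Real.pi]
  ring

/-- A probability asymptotic to a constant times a power `snr ^ (-d)` has diversity order `d`. -/
theorem hasDiversityOrder_of_isEquivalent {ι : Type*} {l : Filter ι} {snr p : ι → ℝ} {c : ℝ}
    (hc : 0 < c) (d : ℕ) (hsnr : Tendsto snr l atTop)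
    (h : p ~[l] fun i => c * (snr i)⁻¹ ^ d) : HasDiversityOrder l snr p d := by
  have hpos : ∀ᶠ i in l, 0 < snr i := hsnr.eventually_gt_atTop 0
  have hlog : Tendsto (fun i => Real.log (snr i)) l atTop := Real.tendsto_log_atTop.comp hsnr
  have hne : ∀ᶠ i in l, c * (snr i)⁻¹ ^ d ≠ 0 := by
    filter_upwards [hpos] with i hi
    positivity
  have hratio : Tendsto (fun i => p i / (c * (snr i)⁻¹ ^ d)) l (𝓝 1) :=
    (isEquivalent_iff_tendsto_one hne).1 h
  have hlogratio : Tendsto (fun i => Real.log (p i / (c * (snr i)⁻¹ ^ d))) l (𝓝 0) := by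
    simpa using hratio.log one_ne_zero
  -- This is `-log p / log snr` after writing `p = (p / (c snr⁻ᵈ)) · c · snr⁻ᵈ`; the bounded
  -- logarithms vanish against `log snr`.
  have hmain : Tendsto (fun i => (d : ℝ) - (Real.log c +
      Real.log (p i / (c * (snr i)⁻¹ ^ d))) / Real.log (snr i)) l (𝓝 d) := by
    simpa using ((hlogratio.const_add (Real.log c)).div_atTop hlog).const_sub (d : ℝ)
  refine hmain.congr' ?_
  filter_upwards [hpos, hlog.eventually_gt_atTop 0, hratio.eventually_ne one_ne_zero]
    with i hi hli hri
  have hp : p i ≠ 0 := fun h0 => hri (by rw [h0, zero_div])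
  rw [Real.log_div hp (by positivity), Real.log_mul hc.ne' (by positivity), Real.log_pow,
    Real.log_inv]
  field_simp
  ring

end FAS

theorem mainTheorem4 (M K : ℕ) (hK : 1 ≤ K) (hKM : K ≤ M) (R μ : ℝ) (hR : 0 < R)
    (hμ0 : 0 ≤ μ) (hμ1 : μ < 1)
    {ι : Type*} (l : Filter ι) (PS α N : ι → ℝ)
    (hPS : ∀ i, 0 < PS i) (hα : ∀ i, 0 < α i) (hN : ∀ i, 0 < N i)
    (hSNR : Tendsto (fun i => FAS.avgSNR (PS i) (α i) (N i)) l atTop) :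
    (K < M →
      (fun i => FAS.outageProb M K R (PS i) (α i) (N i) μ) ~[l]
        (fun i => FAS.psi M K μ *
          (((2 : ℝ) ^ R - 1) * FAS.omega (FAS.avgSNR (PS i) (α i) (N i)) μ) ^ M)) ∧
    FAS.HasDiversityOrder l (fun i => FAS.avgSNR (PS i) (α i) (N i))
      (fun i => FAS.outageProb M K R (PS i) (α i) (N i) μ) (M : ℝ) := by
  have h := FAS.isEquivalent_outageProb hK hKM hR hμ0 hμ1 hPS hα hN hSNR
  refine ⟨fun hlt => ?_, ?_⟩
  · rwa [FAS.psi_eq_outageCoefficient hK hlt]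
  have hz : 0 < (2 : ℝ) ^ R - 1 := sub_pos.2 (Real.one_lt_rpow one_lt_two hR)
  have hμ' : 0 < 1 - μ := sub_pos.2 hμ1
  have hc := FAS.outageCoefficient_pos hK hKM hμ0 hμ1
  -- The fixed factors `z` and `(1 - μ)⁻¹` of `z ω` are absorbed into `c`, leaving a pure power of
  -- `φ⁻¹`.
  refine FAS.hasDiversityOrder_of_isEquivalent
    (c := FAS.outageCoefficient M K μ * (((2 : ℝ) ^ R - 1) * (1 - μ)⁻¹) ^ M)
    (by positivity) M hSNR (h.congr_right (Eventually.of_forall fun i => ?_))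
  simp only [FAS.omega]
  rw [mul_assoc, ← mul_pow, mul_inv]
  ring
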